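/- Let $p$ be an odd prime, let $\Gamma_0(p)=\{\left(\begin{smallmatrix}a&b\\c&d\end{smallmatrix}\right)\in\mathrm{SL}_2(\mathbb Z): p\mid c\}$, and let $\Gamma_0^+(p)$ be the normalizer of $\Gamma_0(p)$ in $\mathrm{SL}_2(\mathbb R)$. Throughout, $\operatorname{sgn}(0)=0$ and, unless a branch is mentioned, $\log$ is the principal branch, with imaginary part in $(-\pi,\pi]$. For coprime integers $h,k$ with $k\ge 1$ let $s(h,k)=\sum_{\mu=1}^{k}\left(\!\left(\frac{h\mu}{k}\right)\!\right)\left(\!\left(\frac{\mu}{k}\right)\!\right)$, where $((x))=x-\lfloor x\rfloor-\frac12$ if $x\notin\mathbb Z$ and $((x))=0$ if $x\in\mathbb Z$. For $\gamma=\left(\begin{smallmatrix}a&b\\c&d\end{smallmatrix}\right)\in\mathrm{SL}_2(\mathbb Z)$ put $$\Phi(\gamma)=\begin{cases}\frac bd & \text{if } c=0,\\ \frac{a+d}{c}-12\operatorname{sgn}(c)\,s(d,|c|) & \text{if } c\ne 0.\end{cases}$$ For $\gamma=\left(\begin{smallmatrix}a&b\\c&d\end{smallmatrix}\right)\in\Gamma_0^+(p)$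 define the Rademacher symbol $$\Phi_p(\gamma)=\begin{cases}\frac12\left[\Phi(\gamma)+\Phi\left(\begin{pmatrix}a&pb\\c/p&d\end{pmatrix}\right)\right] & \text{if }\gamma\in\Gamma_0(p),\\[2mm] \Phi_p\left(\frac1{\sqrt p}\begin{pmatrix}c&d\\-pa&-pb\end{pmatrix}\right)-3\operatorname{sgn}(-ac) & \text{if }\gamma\notin\Gamma_0(p),\end{cases}$$ where in the second case the matrix on the right lies in $\Gamma_0(p)$. Let $\eta(z)=e^{\pi i z/12}\prod_{n\ge1}(1-e^{2\pi i n z})$ be the Dedekind eta function on the upper half plane $\mathfrak H$. Let $k\ge 1$ be any integer, and let $\Delta_p(z)=\eta(z)^k\eta(pz)^k$. Then there are a continuous function $\eta_p=\Delta_p^{1/2k}$ on $\mathfrak H$ (that is, $\eta_p^{2k}=\Delta_p$) and a continuous branch $\log\eta_p$ of its logarithm on $\mathfrak H$ that on the imaginary axis are given by the principal $2k$-th root of $\Delta_p$ and by the principal logarithm of $\eta_p$. Moreover, for every continuous function $\eta_p$ on $\mathfrak H$ with $\eta_p^{2k}=\Delta_p$, every continuous branch $\log\eta_p$ of its logarithm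 on $\mathfrak H$, every $\gamma=\left(\begin{smallmatrix}a&b\\c&d\end{smallmatrix}\right)\in\Gamma_0^+(p)$ and every $z\in\mathfrak H$, $$\log\eta_p\left(\frac{az+b}{cz+d}\right)=\log\eta_p(z)+\frac12\operatorname{sgn}(c)^2\log\left(\frac{cz+d}{i\operatorname{sgn}(c)}\right)+\frac{\pi i}{12}\Phi_p(\gamma),$$ where the second term on the right is interpreted as $0$ if $c=0$. -/

import Mathlib

open scoped MatrixGroups UpperHalfPlane

namespace EtaFricke

/-- The sawtooth function: `x - ⌊x⌋ - 1/2` if `x` is not an integer, and `0` if it is. -/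
def sawtooth (x : ℚ) : ℚ := if Int.fract x = 0 then 0 else x - ⌊x⌋ - 1 / 2

/-- The Dedekind sum `s(h, k) = ∑_{μ = 1}^{k} ((hμ/k)) ((μ/k))`. -/
def dedekindSum (h : ℤ) (k : ℕ) : ℚ :=
  ∑ μ ∈ Finset.Icc 1 k, sawtooth ((h * μ : ℚ) / k) * sawtooth ((μ : ℚ) / k)

/-- The Rademacher symbol on `SL(2, ℤ)`. -/
def rademacher (γ : SL(2, ℤ)) : ℚ :=
  if γ 1 0 = 0 then (γ 0 1 : ℚ) / γ 1 1
  else ((γ 0 0 : ℚ) + γ 1 1) / γ 1 0 - 12 * (γ 1 0).sign * dedekindSum (γ 1 1) (γ 1 0).natAbs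

/-- The level `Γ₀(p)` as a subgroup of `SL(2, ℝ)`. -/
noncomputable def Gamma0Real (p : ℕ) : Subgroup SL(2, ℝ) :=
  (CongruenceSubgroup.Gamma0 p).map (Matrix.SpecialLinearGroup.map (Int.castRingHom ℝ))

/-- `Γ₀⁺(p)`, the normalizer of `Γ₀(p)` in `SL(2, ℝ)`. -/
noncomputable def Gamma0Plus (p : ℕ) : Subgroup SL(2, ℝ) :=
  Subgroup.normalizer (Gamma0Real p : Set SL(2, ℝ))

/-- The matrix `(a, pb; c/p, d)` in `SL(2, ℤ)` attached to `(a, b; c, d)` in `Γ₀(p)`. -/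
def companion (p : ℕ) (g : CongruenceSubgroup.Gamma0 p) : SL(2, ℤ) :=
  ⟨!![g.1 0 0, p * g.1 0 1; g.1 1 0 / p, g.1 1 1], by
    have hdvd : (p : ℤ) ∣ g.1 1 0 :=
      (ZMod.intCast_zmod_eq_zero_iff_dvd _ p).1 (CongruenceSubgroup.Gamma0_mem.1 g.2)
    have hdet := Matrix.SpecialLinearGroup.det_coe g.1
    rw [Matrix.det_fin_two] at hdet
    rw [Matrix.det_fin_two_of]
    linear_combination hdet - g.1 0 1 * Int.mul_ediv_cancel' hdvd⟩

/-- The symbol `Φ_p` on `Γ₀(p)`: the average of `Φ` at `(a, b; c, d)` and `(a, pb; c/p, d)`. -/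
def rademacherGamma0 (p : ℕ) (g : CongruenceSubgroup.Gamma0 p) : ℚ :=
  (rademacher g.1 + rademacher (companion p g)) / 2

/-- The matrix `(1/√p) (c, d; -pa, -pb)` attached to the real matrix `(a, b; c, d)`. -/
noncomputable def frickeTwist (p : ℕ) (γ : SL(2, ℝ)) : Matrix (Fin 2) (Fin 2) ℝ :=
  (1 / √(p : ℝ)) • !![γ 1 0, γ 1 1; -p * γ 0 0, -p * γ 0 1]

open Classical in
/-- The Rademacher symbol `Φ_p` on `Γ₀⁺(p)`. On `Γ₀(p)` it is the average above; for the other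
elements `(a, b; c, d)` of `Γ₀⁺(p)` it is `Φ_p` of the (integral) matrix `frickeTwist`, minus
`3 sgn(-ac)`. A matrix in neither case does not lie in `Γ₀⁺(p)` and gets the value `0`. The
integral matrix `g` that is chosen in either case is unique. -/
noncomputable def rademacherP (p : ℕ) (γ : SL(2, ℝ)) : ℚ :=
  if h : ∃ g : CongruenceSubgroup.Gamma0 p,
      g.1.1.map (Int.cast : ℤ → ℝ) = (γ : Matrix (Fin 2) (Fin 2) ℝ) then
    rademacherGamma0 p h.choose
  else if h : ∃ g : CongruenceSubgroup.Gamma0 p,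
      g.1.1.map (Int.cast : ℤ → ℝ) = frickeTwist p γ then
    rademacherGamma0 p h.choose - 3 * (SignType.sign (-(γ 0 0 * γ 1 0)) : ℚ)
  else 0

/-- `Δ_p(z) = η(z)^k η(pz)^k` on the upper half plane. -/
noncomputable def deltaP (p k : ℕ) (z : ℍ) : ℂ :=
  ModularForm.eta (z : ℂ) ^ k * ModularForm.eta (p * (z : ℂ)) ^ k

/-- `f` is a branch of `η_p = (η(z)^k η(pz)^k)^{1/(2k)}` on the upper half plane. -/
def IsEtaP (p k : ℕ) (f : ℍ → ℂ) : Prop :=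
  Continuous f ∧ ∀ z, f z ^ (2 * k) = deltaP p k z

/-- `L` is a branch of `log f` on the upper half plane. -/
def IsLogBranch (f L : ℍ → ℂ) : Prop :=
  Continuous L ∧ ∀ z, Complex.exp (L z) = f z

end EtaFricke

/-! Both assertions reduce to one explicit logarithm. The product formula gives a continuous
`logEta` on the upper half plane with exponential η, and `logEtaP p z` is the mean of `logEta z` and
`logEta (p * z)`. It is real on the imaginary axis, which gives the normalized branch. For any other
admissible branch L, 2k·L and 2k·`logEtaP` have equal exponentials, so L - `logEtaP` is constant on
the connected half plane, and L(γz) - L(z) does not depend on L.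

For `logEta` and SL(2, ℤ), the formula is carried along words in S and T (`logEtaTransforms`). Two
computations have to agree at S. The terms `autLog (cz + d)` are additive up to (πi/2) times a
product of three signs (`autLog_mul`), and `rademacher` changes by -3 sgn(c) sgn(d) under γ ↦ γS
(`rademacher_mul_S`), which is Dedekind reciprocity.

On Γ₀(p), the formula for `logEtaP` is the mean of the formulas for γ at z and its companion at pz.
The normalizer is contained in the union of Γ₀(p) and one further coset (`mem_Gamma0Plus_cases`). On
that coset the Fricke involution composed with γ lies in Γ₀(p), and the sign term of `autLog_mul`
becomes -3 sgn(-ac). -/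

namespace EtaFricke

open Complex ModularGroup


/-! ### Logarithms of automorphy factors and their cocycle -/

/-- The normalized logarithm `sgn(Im u)² log (u / (i sgn(Im u)))`. -/
noncomputable def autLog (u : ℂ) : ℂ :=
  ((SignType.sign u.im : ℝ) : ℂ) ^ 2 * log (u / (I * ((SignType.sign u.im : ℝ) : ℂ)))

lemma autLog_of_im_eq_zero {u : ℂ} (h : u.im = 0) : autLog u = 0 := by simp [autLog, h]

lemma autLog_of_im_pos {u : ℂ} (h : 0 < u.im) : autLog u = log (u / I) := by simp [autLog, h]

lemma autLog_of_im_neg {u : ℂ} (h : u.im < 0) : autLog u = log (-u / I) := by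
  simp [autLog, h, div_neg, neg_div]

lemma autLog_neg (u : ℂ) : autLog (-u) = autLog u := by
  rcases lt_trichotomy u.im 0 with h | h | h
  · rw [autLog_of_im_neg h, autLog_of_im_pos (by simpa using h)]
  · rw [autLog_of_im_eq_zero h, autLog_of_im_eq_zero (by simpa using h)]
  · rw [autLog_of_im_pos h, autLog_of_im_neg (by simpa using h), neg_neg]

lemma div_I_re (u : ℂ) : (u / I).re = u.im := by simp [div_I]

lemma abs_autLog_im_lt {u : ℂ} : |(autLog u).im| < Real.pi / 2 := by
  rcases lt_trichotomy u.im 0 with h | h | h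
  · rw [autLog_of_im_neg h, log_im, abs_arg_lt_pi_div_two_iff, div_I_re]
    left; simpa using h
  · rw [autLog_of_im_eq_zero h]; simp [Real.pi_pos]
  · rw [autLog_of_im_pos h, log_im, abs_arg_lt_pi_div_two_iff, div_I_re]
    exact .inl h

lemma exp_autLog {u : ℂ} (h : u.im ≠ 0) :
    exp (autLog u) = u / (I * ((SignType.sign u.im : ℝ) : ℂ)) := by
  have hu : u ≠ 0 := fun h0 => h (by simp [h0])
  rcases lt_or_gt_of_ne h with h | h
  · rw [autLog_of_im_neg h, exp_log (by simp [hu])]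
    simp [h, div_neg, neg_div]
  · rw [autLog_of_im_pos h, exp_log (by simp [hu])]
    simp [h]

/-- For Im u > 0, u / i has positive real part, so its argument is not π and the principal logarithm
respects inversion; the other cases follow from evenness. -/
lemma autLog_inv {u : ℂ} : autLog u⁻¹ = -autLog u := by
  wlog h : 0 < u.im generalizing u
  · rcases lt_or_eq_of_le (not_lt.1 h) with h | h
    · rw [← autLog_neg, ← inv_neg, this (by simpa using h), autLog_neg]
    · rw [autLog_of_im_eq_zero h, autLog_of_im_eq_zero (by simp [inv_im, h]), neg_zero]
  have hu : u ≠ 0 := fun h0 => by simp [h0] at h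
  have h' : u⁻¹.im < 0 := by
    rw [inv_im]
    exact div_neg_of_neg_of_pos (by simpa using h) (normSq_pos.2 hu)
  rw [autLog_of_im_neg h', autLog_of_im_pos h, ← log_inv]
  · congr 1
    field_simp
    simp
  · intro hpi
    have := (abs_arg_lt_pi_div_two_iff (z := u / I)).2 (.inl (by rwa [div_I_re]))
    rw [hpi, abs_of_pos Real.pi_pos] at this
    linarith [Real.pi_pos]

lemma eq_of_exp_eq_of_abs_im_sub_lt {x y : ℂ} (h : exp x = exp y)
    (hxy : |(x - y).im| < 2 * Real.pi) : x = y := by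
  obtain ⟨n, hn⟩ := exp_eq_exp_iff_exists_int.1 h
  have him : (x - y).im = n * (2 * Real.pi) := by simp [hn]
  rw [him, abs_mul, abs_of_pos Real.two_pi_pos] at hxy
  have h1 : |(n : ℝ)| < 1 := by
    by_contra! h1
    nlinarith [Real.pi_pos]
  have h2 : n = 0 := Int.abs_lt_one_iff.1 (by exact_mod_cast h1)
  simp [hn, h2]

/-- The cocycle relation of the normalized logarithm. -/
lemma autLog_mul {u v : ℂ} (hu : u.im = 0 → u = 1 ∨ u = -1) (hv : v.im = 0 → v = 1 ∨ v = -1)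
    (huv : (u * v).im = 0 → u * v = 1 ∨ u * v = -1) :
    autLog (u * v) = autLog u + autLog v + I * Real.pi / 2 *
      (((SignType.sign u.im : ℝ) : ℂ) * ((SignType.sign v.im : ℝ) : ℂ) *
        ((SignType.sign (u * v).im : ℝ) : ℂ)) := by
  -- On real numbers `autLog` is 0 by convention. The cocycle survives this only because the real
  -- values allowed are ±1 and `autLog` is even.
  by_cases h1 : u.im = 0
  · rw [autLog_of_im_eq_zero h1]
    rcases hu h1 with rfl | rfl <;> simp [autLog_neg]
  by_cases h2 : v.im = 0
  · rw [autLog_of_im_eq_zero h2]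
    rcases hv h2 with rfl | rfl <;> simp [autLog_neg]
  by_cases h3 : (u * v).im = 0
  · rw [autLog_of_im_eq_zero h3, h3]
    have hu0 : u ≠ 0 := fun h0 => h1 (by simp [h0])
    rcases huv h3 with h | h
    · rw [eq_inv_of_mul_eq_one_right h, autLog_inv]; simp
    · rw [show v = -u⁻¹ by field_simp; linear_combination h, autLog_neg, autLog_inv]; simp
  have hexp : ∀ s : SignType, s ≠ 0 → exp (I * Real.pi / 2 * ((s : ℝ) : ℂ)) = I * ((s : ℝ) : ℂ) := by
    intro s hs
    have hI : exp (I * Real.pi / 2) = I := by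
      rw [show I * (Real.pi : ℂ) / 2 = Real.pi / 2 * I by ring, exp_pi_div_two_mul_I]
    cases s
    · exact absurd rfl hs
    · simp [exp_neg, hI]
    · simpa using hI
  have hne : ∀ x : ℝ, x ≠ 0 → ((SignType.sign x : ℝ) : ℂ) ^ 2 = 1 := by
    intro x hx
    rcases lt_or_gt_of_ne hx with h | h <;> simp [h]
  have hs : (SignType.sign u.im * SignType.sign v.im * SignType.sign (u * v).im : SignType) ≠ 0 := by
    simp [sign_eq_zero_iff, h1, h2, -mul_im, h3]
  have hcast : ((SignType.sign u.im : ℝ) : ℂ) * ((SignType.sign v.im : ℝ) : ℂ) *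
        ((SignType.sign (u * v).im : ℝ) : ℂ) =
      (((SignType.sign u.im * SignType.sign v.im * SignType.sign (u * v).im : SignType) : ℝ) : ℂ) := by
    push_cast; rfl
  -- The exponentials agree. Each of the three logarithms has imaginary part below π/2 in absolute
  -- value and the correction at most π/2, so the two sides differ by less than 2π in imaginary
  -- part.
  apply eq_of_exp_eq_of_abs_im_sub_lt
  · rw [hcast, exp_add, exp_add, exp_autLog h1, exp_autLog h2, exp_autLog h3, hexp _ hs, ← hcast]
    have e1 := hne _ h1
    have e2 := hne _ h2
    have e3 := hne _ h3
    set s := ((SignType.sign u.im : ℝ) : ℂ)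
    set t := ((SignType.sign v.im : ℝ) : ℂ)
    set r := ((SignType.sign (u * v).im : ℝ) : ℂ)
    have n1 : s ≠ 0 := fun h => by simp [h] at e1
    have n2 : t ≠ 0 := fun h => by simp [h] at e2
    have n3 : r ≠ 0 := fun h => by simp [h] at e3
    field_simp
    rw [e3, mul_one]
  · rw [hcast]
    have b1 := abs_lt.1 (abs_autLog_im_lt (u := u))
    have b2 := abs_lt.1 (abs_autLog_im_lt (u := v))
    have b3 := abs_lt.1 (abs_autLog_im_lt (u := u * v))
    have b4 : ∀ s : SignType, |(s : ℝ)| ≤ 1 := by intro s; cases s <;> simp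
    have b5 := abs_le.1 (b4 (SignType.sign u.im * SignType.sign v.im * SignType.sign (u * v).im))
    have him : ∀ r : ℝ, (I * Real.pi / 2 * (r : ℂ)).im = Real.pi / 2 * r := by
      intro r
      rw [show I * (Real.pi : ℂ) / 2 * (r : ℂ) = ((Real.pi / 2 * r : ℝ) : ℂ) * I by push_cast; ring]
      rw [im_ofReal_mul, I_im, mul_one]
    rw [sub_im, add_im, add_im, him, abs_lt]
    have := Real.pi_pos
    constructor <;> nlinarith


/-! ### Dedekind sums and reciprocity -/

open Finset in
lemma sum_range_id_sq (k : ℕ) :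
    (∑ μ ∈ range k, (μ : ℚ)) = k * (k - 1) / 2 ∧
      (∑ μ ∈ range k, (μ : ℚ) ^ 2) = k * (k - 1) * (2 * k - 1) / 6 := by
  induction k with
  | zero => simp
  | succ k ih =>
    rw [sum_range_succ, sum_range_succ, ih.1, ih.2]
    push_cast
    constructor <;> ring

open Finset in
/-- Multiplication by a unit permutes the residues. -/
lemma sum_range_mul_mod {h k : ℕ} (hc : h.Coprime k) (hk : 0 < k) (f : ℕ → ℚ) :
    ∑ μ ∈ range k, f (h * μ % k) = ∑ μ ∈ range k, f μ := by
  have hinj : Set.InjOn (fun μ => h * μ % k) (range k : Set ℕ) := by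
    intro a ha b hb hab
    simp only [coe_range, Set.mem_Iio] at ha hb
    have h1 : h * a ≡ h * b [MOD k] := hab
    exact (Nat.ModEq.cancel_left_of_coprime (by rwa [Nat.gcd_comm]) h1).eq_of_lt_of_lt ha hb
  have himg : (range k).image (fun μ => h * μ % k) = range k := by
    apply eq_of_subset_of_card_le
    · intro x hx
      obtain ⟨μ, _, rfl⟩ := mem_image.1 hx
      exact mem_range.2 (Nat.mod_lt _ hk)
    · rw [card_image_of_injOn hinj]
  conv_rhs => rw [← himg]
  rw [sum_image hinj]

lemma sawtooth_natCast_div {h k : ℕ} (hk : 0 < k) (hd : ¬ k ∣ h) :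
    sawtooth ((h : ℚ) / k) = (h % k : ℕ) / k - 1 / 2 := by
  have hf : (h : ℚ) / k - ⌊(h : ℚ) / k⌋ = (h % k : ℕ) / k := by
    have : ⌊(h : ℚ) / k⌋ = ((h / k : ℕ) : ℤ) := by
      rw [← Nat.floor_div_eq_div (K := ℚ), Int.natCast_floor_eq_floor (by positivity)]
    rw [this, Int.cast_natCast]
    have h2 : (h : ℚ) = k * (h / k : ℕ) + (h % k : ℕ) := by exact_mod_cast (Nat.div_add_mod h k).symm
    have : (k : ℚ) ≠ 0 := by positivity
    field_simp
    linarith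
  have hne : Int.fract ((h : ℚ) / k) ≠ 0 := by
    rw [Int.fract, hf]
    have : h % k ≠ 0 := fun h0 => hd (Nat.dvd_of_mod_eq_zero h0)
    positivity
  rw [sawtooth, if_neg hne, hf]

lemma sawtooth_intCast (n : ℤ) : sawtooth n = 0 := by simp [sawtooth]

lemma sawtooth_add_int (x : ℚ) (n : ℤ) : sawtooth (x + n) = sawtooth x := by
  simp only [sawtooth, Int.fract_add_intCast, Int.floor_add_intCast]
  push_cast
  congr 1
  ring

lemma sawtooth_neg (x : ℚ) : sawtooth (-x) = -sawtooth x := by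
  by_cases h : Int.fract x = 0
  · have h' : Int.fract (-x) = 0 := Int.fract_neg_eq_zero.2 h
    simp [sawtooth, h, h']
  · have h' : Int.fract (-x) ≠ 0 := fun h0 => h (Int.fract_neg_eq_zero.1 h0)
    have h1 := Int.fract_neg h
    rw [sawtooth, sawtooth, if_neg h, if_neg h']
    simp only [Int.fract] at h1
    linarith

lemma dedekindSum_add_self (h : ℤ) (k : ℕ) (m : ℤ) :
    dedekindSum (h + m * k) k = dedekindSum h k := by
  refine Finset.sum_congr rfl fun μ hμ => ?_
  have hk : (k : ℚ) ≠ 0 := by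
    have := Finset.mem_Icc.1 hμ
    have : 0 < k := by omega
    positivity
  rw [← sawtooth_add_int (h * μ / k) (m * μ)]
  congr 2
  push_cast
  field_simp

lemma dedekindSum_neg (h : ℤ) (k : ℕ) : dedekindSum (-h) k = -dedekindSum h k := by
  rw [dedekindSum, dedekindSum, ← Finset.sum_neg_distrib]
  refine Finset.sum_congr rfl fun μ _ => ?_
  rw [← neg_mul, ← sawtooth_neg]
  congr 2
  push_cast
  ring

lemma dedekindSum_zero_left (k : ℕ) : dedekindSum 0 k = 0 := by
  have := sawtooth_intCast 0
  simp at this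
  simp [dedekindSum, this]

open Finset in
lemma dedekindSum_eq_sum_div {h k : ℕ} (hc : h.Coprime k) (hk : 0 < k) :
    dedekindSum h k = (h * ∑ μ ∈ range k, (μ : ℚ) ^ 2
      - k * ∑ μ ∈ range k, (μ : ℚ) * (h * μ / k : ℕ)) / k ^ 2 - (k - 1) / 4 := by
  have hk0 : (k : ℚ) ≠ 0 := by positivity
  have hmod : ∀ μ : ℕ, ((h * μ % k : ℕ) : ℚ) = h * μ - k * (h * μ / k : ℕ) := by
    intro μ
    have : (h * μ : ℚ) = k * (h * μ / k : ℕ) + (h * μ % k : ℕ) := by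
      exact_mod_cast (Nat.div_add_mod (h * μ) k).symm
    linarith
  -- The sum is moved from 1, ..., k to 0, ..., k - 1: the term μ = k vanishes, while the linear
  -- expression at μ = 0 contributes (-1/2)², subtracted as 1/4.
  have h1 : dedekindSum h k = ∑ μ ∈ range k,
      ((((h * μ % k : ℕ) : ℚ) / k - 1 / 2) * ((μ : ℚ) / k - 1 / 2)) - 1 / 4 := by
    obtain ⟨n, rfl⟩ : ∃ n, k = n + 1 := ⟨k - 1, by omega⟩
    have hlast : sawtooth (((n + 1 : ℕ) : ℚ) / (n + 1 : ℕ)) = 0 := by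
      rw [div_self hk0]
      exact_mod_cast sawtooth_intCast 1
    have hIcc : Icc 1 (n + 1) = Ico 1 (n + 1 + 1) := by ext; simp
    rw [dedekindSum, hIcc, sum_Ico_eq_sum_range, Nat.add_sub_cancel, sum_range_succ, sum_range_succ',
      add_comm 1 n, hlast, mul_zero, add_zero, eq_sub_iff_add_eq]
    congr 1
    · refine sum_congr rfl fun i hi => ?_
      have hi' := mem_range.1 hi
      have hd : ¬ n + 1 ∣ i + 1 := fun hd => by
        have := Nat.le_of_dvd (by omega) hd
        omega
      have e1 := sawtooth_natCast_div hk hd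
      have e2 := sawtooth_natCast_div hk (h := h * (i + 1)) fun hd' =>
        hd (hc.symm.dvd_of_dvd_mul_left hd')
      rw [Nat.mod_eq_of_lt (by omega)] at e1
      rw [add_comm 1 i, e1, ← e2]
      push_cast
      rfl
    · norm_num
  have h2 : ∑ μ ∈ range k, ((h * μ % k : ℕ) : ℚ) = k * (k - 1) / 2 := by
    rw [sum_range_mul_mod hc hk (fun x => (x : ℚ)), (sum_range_id_sq k).1]
  have h3 : ∑ μ ∈ range k,
      ((((h * μ % k : ℕ) : ℚ) / k - 1 / 2) * ((μ : ℚ) / k - 1 / 2)) =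
      (∑ μ ∈ range k, ((h * μ % k : ℕ) : ℚ) * μ) / k ^ 2
        - (∑ μ ∈ range k, ((h * μ % k : ℕ) : ℚ)) / (2 * k) - (∑ μ ∈ range k, (μ : ℚ)) / (2 * k)
        + k / 4 := by
    rw [sum_div, sum_div, sum_div, ← sum_sub_distrib, ← sum_sub_distrib]
    have : (k : ℚ) / 4 = ∑ μ ∈ range k, (1 / 4 : ℚ) := by simp; ring
    rw [this, ← sum_add_distrib]
    refine sum_congr rfl fun μ _ => ?_
    field_simp
    ring
  have h4 : ∑ μ ∈ range k, ((h * μ % k : ℕ) : ℚ) * μ = h * ∑ μ ∈ range k, (μ : ℚ) ^ 2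
      - k * ∑ μ ∈ range k, (μ : ℚ) * (h * μ / k : ℕ) := by
    rw [mul_sum, mul_sum, ← sum_sub_distrib]
    refine sum_congr rfl fun μ _ => ?_
    rw [hmod]
    ring
  rw [h1, h3, h4, h2, (sum_range_id_sq k).1]
  field_simp
  ring

-- The remainders hμ - k⌊hμ/k⌋ run through all residues mod k, so their sum and their sum of squares
-- are known; expanding these gives the two relations.
open Finset in
lemma sum_mul_div_eq {h k : ℕ} (hc : h.Coprime k) (hk : 0 < k) :
    2 * h * k * ∑ μ ∈ range k, (μ : ℚ) * (h * μ / k : ℕ) =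
      (h ^ 2 - 1) * ∑ μ ∈ range k, (μ : ℚ) ^ 2 +
        k ^ 2 * ∑ μ ∈ range k, ((h * μ / k : ℕ) : ℚ) ^ 2 ∧
    ∑ μ ∈ range k, ((h * μ / k : ℕ) : ℚ) = (h - 1) * (k - 1) / 2 := by
  have hk0 : (k : ℚ) ≠ 0 := by positivity
  have hmod : ∀ μ : ℕ, ((h * μ % k : ℕ) : ℚ) = h * μ - k * (h * μ / k : ℕ) := by
    intro μ
    have : (h * μ : ℚ) = k * (h * μ / k : ℕ) + (h * μ % k : ℕ) := by
      exact_mod_cast (Nat.div_add_mod (h * μ) k).symm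
    linarith
  have h1 := sum_range_mul_mod hc hk (fun x => (x : ℚ))
  have h2 := sum_range_mul_mod hc hk (fun x => (x : ℚ) ^ 2)
  simp only [hmod] at h1 h2
  constructor
  · have h3 : ∑ μ ∈ range k, ((h : ℚ) * μ - k * (h * μ / k : ℕ)) ^ 2 =
        h ^ 2 * ∑ μ ∈ range k, (μ : ℚ) ^ 2
          - 2 * h * k * ∑ μ ∈ range k, (μ : ℚ) * (h * μ / k : ℕ)
          + k ^ 2 * ∑ μ ∈ range k, ((h * μ / k : ℕ) : ℚ) ^ 2 := by
      rw [mul_sum, mul_sum, mul_sum, ← sum_sub_distrib, ← sum_add_distrib]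
      exact sum_congr rfl fun μ _ => by ring
    linarith
  · rw [sum_sub_distrib, ← mul_sum, ← mul_sum, (sum_range_id_sq k).1] at h1
    field_simp
    field_simp at h1
    linarith

open Finset in
/-- Counting lattice points under the diagonal in two ways. -/
lemma sum_div_mul_succ {h k : ℕ} (hc : h.Coprime k) (hk : 0 < k) (hh : 0 < h) :
    ∑ μ ∈ range k, ((h * μ / k : ℕ) : ℚ) * ((h * μ / k : ℕ) + 1) =
      (k - 1) * h * (h - 1) - 2 * ∑ ν ∈ range h, (ν : ℚ) * (k * ν / h : ℕ) := by
  -- q(q + 1) is twice the sum of all ν ≤ q; this turns the left side into a weighted count of pairs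
  -- (μ, ν) with ν ≤ hμ/k, which can be summed over μ first.
  have htri : ∀ q < h, (q : ℚ) * (q + 1) = ∑ ν ∈ range h, if ν ≤ q then 2 * (ν : ℚ) else 0 := by
    intro q hq
    rw [← sum_filter, show (range h).filter (· ≤ q) = range (q + 1) by ext; simp; omega, ← mul_sum,
      (sum_range_id_sq _).1]
    push_cast
    ring
  have hlt : ∀ μ ∈ range k, h * μ / k < h := fun μ hμ => by
    rw [Nat.div_lt_iff_lt_mul hk]
    exact Nat.mul_lt_mul_of_pos_left (mem_range.1 hμ) hh
  have hcount : ∀ ν ∈ range h, 0 < ν →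
      (((range k).filter fun μ => ν ≤ h * μ / k).card : ℚ) = k - 1 - (k * ν / h : ℕ) := by
    intro ν hν h0
    have hν' := mem_range.1 hν
    have hset : (range k).filter (fun μ => ν ≤ h * μ / k) = Ico (k * ν / h + 1) k := by
      ext μ
      simp only [mem_filter, mem_range, mem_Ico, Nat.le_div_iff_mul_le hk, Nat.succ_le_iff,
        Nat.div_lt_iff_lt_mul hh]
      -- By coprimality no lattice point with 0 < ν < h lies on the diagonal, so weak and strict
      -- inequalities count the same points.
      have hne : μ < k → ν * k ≠ h * μ := by
        intro hμ he
        have : h ∣ ν * k := ⟨μ, he⟩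
        have := Nat.le_of_dvd h0 (hc.dvd_of_dvd_mul_right this)
        omega
      rw [mul_comm k ν, mul_comm μ h]
      constructor
      · rintro ⟨a, b⟩
        exact ⟨lt_of_le_of_ne b (hne a), a⟩
      · rintro ⟨a, b⟩
        exact ⟨b, a.le⟩
    have hle : k * ν / h + 1 ≤ k := by
      rw [Nat.succ_le_iff, Nat.div_lt_iff_lt_mul hh]
      exact Nat.mul_lt_mul_of_pos_left hν' hk
    rw [hset, Nat.card_Ico, Nat.cast_sub hle]
    push_cast
    ring
  calc _ = ∑ μ ∈ range k, ∑ ν ∈ range h, if ν ≤ h * μ / k then 2 * (ν : ℚ) else 0 :=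
        sum_congr rfl fun μ hμ => htri _ (hlt μ hμ)
    _ = ∑ ν ∈ range h, 2 * (ν : ℚ) * (k - 1 - (k * ν / h : ℕ)) := by
        rw [sum_comm]
        refine sum_congr rfl fun ν hν => ?_
        rcases Nat.eq_zero_or_pos ν with rfl | h0
        · simp
        · rw [← hcount ν hν h0, ← sum_filter, sum_const, nsmul_eq_mul, mul_comm]
    _ = (k - 1) * (2 * ∑ ν ∈ range h, (ν : ℚ)) - 2 * ∑ ν ∈ range h, (ν : ℚ) * (k * ν / h : ℕ) := by
        rw [mul_sum, mul_sum, mul_sum, ← sum_sub_distrib]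
        exact sum_congr rfl fun ν _ => by ring
    _ = _ := by
        rw [(sum_range_id_sq h).1]
        ring

/-- Dedekind reciprocity. -/
theorem dedekindSum_reciprocity {h k : ℕ} (hc : h.Coprime k) (hk : 0 < k) (hh : 0 < h) :
    dedekindSum h k + dedekindSum k h = -1 / 4 + ((h : ℚ) / k + k / h + 1 / (h * k)) / 12 := by
  have hk0 : (k : ℚ) ≠ 0 := by positivity
  have hh0 : (h : ℚ) ≠ 0 := by positivity
  obtain ⟨h1, h2⟩ := sum_mul_div_eq hc hk
  have h3 := sum_div_mul_succ hc hk hh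
  rw [dedekindSum_eq_sum_div hc hk, dedekindSum_eq_sum_div hc.symm hh, (sum_range_id_sq k).2,
    (sum_range_id_sq h).2]
  rw [(sum_range_id_sq k).2] at h1
  simp only [mul_add, mul_one, Finset.sum_add_distrib, ← pow_two, h2] at h3
  set A := ∑ μ ∈ Finset.range k, (μ : ℚ) * (h * μ / k : ℕ)
  set A' := ∑ ν ∈ Finset.range h, (ν : ℚ) * (k * ν / h : ℕ)
  set B := ∑ μ ∈ Finset.range k, ((h * μ / k : ℕ) : ℚ) ^ 2
  -- Both A and A' are affine in B, and B cancels in the sum of the two Dedekind sums.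
  have hA : A = ((h ^ 2 - 1) * (k * (k - 1) * (2 * k - 1) / 6) + k ^ 2 * B) / (2 * h * k) := by
    field_simp
    field_simp at h1
    linarith
  have hA' : A' = ((k - 1) * h * (h - 1) - B - (h - 1) * (k - 1) / 2) / 2 := by linarith
  rw [hA, hA']
  field_simp
  ring


/-! ### The Rademacher symbol under right multiplication by T and S -/

lemma rademacher_mul_T (γ : SL(2, ℤ)) : rademacher (γ * T) = rademacher γ + 1 := by
  have e : ∀ i, (γ * T) i 0 = γ i 0 ∧ (γ * T) i 1 = γ i 0 + γ i 1 := by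
    intro i
    rw [Matrix.SpecialLinearGroup.coe_mul]
    simp [T, Matrix.mul_apply, Fin.sum_univ_two]
  have hdet := γ.det_coe
  rw [Matrix.det_fin_two] at hdet
  simp only [rademacher, e]
  split_ifs with h
  · rw [h, mul_zero, sub_zero] at hdet
    rcases Int.mul_eq_one_iff_eq_one_or_neg_one.1 hdet with ⟨h1, h2⟩ | ⟨h1, h2⟩ <;>
    · rw [h, h1, h2]
      push_cast
      ring
  · have : (γ 1 0 : ℚ) ≠ 0 := by exact_mod_cast h
    have h1 := dedekindSum_add_self (γ 1 1) (γ 1 0).natAbs (γ 1 0).sign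
    rw [Int.sign_mul_natAbs] at h1
    rw [add_comm (γ 1 0), h1]
    push_cast
    field_simp
    ring

lemma dedekindSum_natAbs (h : ℤ) (k : ℕ) :
    dedekindSum h k = h.sign * dedekindSum h.natAbs k := by
  rcases lt_trichotomy h 0 with hh | rfl | hh
  · rw [Int.sign_eq_neg_one_of_neg hh, Int.ofNat_natAbs_of_nonpos hh.le, dedekindSum_neg]
    simp
  · simp [dedekindSum_zero_left]
  · rw [Int.sign_eq_one_of_pos hh, Int.natAbs_of_nonneg hh.le]
    simp

/-- The reciprocity law with signs. -/
lemma dedekindSum_reciprocity_int {c d : ℤ} (hcd : IsCoprime c d) (hc : c ≠ 0) (hd : d ≠ 0) :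
    c.sign * dedekindSum d c.natAbs + d.sign * dedekindSum c d.natAbs =
      -(c.sign * d.sign) / 4 + ((c : ℚ) / d + d / c + 1 / (c * d)) / 12 := by
  have h := dedekindSum_reciprocity (Int.isCoprime_iff_gcd_eq_one.1 hcd : c.natAbs.Coprime d.natAbs)
    (Int.natAbs_pos.2 hd) (Int.natAbs_pos.2 hc)
  rw [dedekindSum_natAbs d, dedekindSum_natAbs c]
  have e1 : (c : ℚ) = c.sign * c.natAbs := by 
    rw [← Int.cast_natCast c.natAbs, ← Int.cast_mul, Int.sign_mul_natAbs]
  have e2 : (d : ℚ) = d.sign * d.natAbs := by 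
    rw [← Int.cast_natCast d.natAbs, ← Int.cast_mul, Int.sign_mul_natAbs]
  have s1 : (c.sign : ℚ) ^ 2 = 1 := by
    rcases lt_or_gt_of_ne hc with h | h
    · simp [Int.sign_eq_neg_one_of_neg h]
    · simp [Int.sign_eq_one_of_pos h]
  have s2 : (d.sign : ℚ) ^ 2 = 1 := by
    rcases lt_or_gt_of_ne hd with h | h
    · simp [Int.sign_eq_neg_one_of_neg h]
    · simp [Int.sign_eq_one_of_pos h]
  rw [e1, e2]
  have n1 : (c.natAbs : ℚ) ≠ 0 := by simpa using hc
  have n2 : (d.natAbs : ℚ) ≠ 0 := by simpa using hd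
  have n3 : (c.sign : ℚ) ≠ 0 := fun h => by simp [h] at s1
  have n4 : (d.sign : ℚ) ≠ 0 := fun h => by simp [h] at s2
  set s := (c.sign : ℚ)
  set t := (d.sign : ℚ)
  have hs : s⁻¹ = s := by field_simp; exact s1.symm
  have ht : t⁻¹ = t := by field_simp; exact s2.symm
  calc _ = s * t * (dedekindSum c.natAbs d.natAbs + dedekindSum d.natAbs c.natAbs) := by ring
    _ = _ := by
      rw [h]
      simp only [div_eq_mul_inv, mul_inv, hs, ht]
      ring

/-- The bottom row (c, d) becomes (d, -c), so the difference of the two Dedekind terms is a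
reciprocity sum. Its rational part cancels against the trace terms by ad - bc = 1, and -3 sgn(c)
sgn(d) remains. -/
lemma rademacher_mul_S (γ : SL(2, ℤ)) :
    rademacher (γ * S) = rademacher γ - 3 * ((γ 1 0).sign * (γ 1 1).sign) := by
  have e : ∀ i, (γ * S) i 0 = γ i 1 ∧ (γ * S) i 1 = -γ i 0 := by
    intro i
    rw [Matrix.SpecialLinearGroup.coe_mul]
    simp [S, Matrix.mul_apply, Fin.sum_univ_two]
  have hdet := γ.det_coe
  rw [Matrix.det_fin_two] at hdet
  set a := γ 0 0 with ha
  set b := γ 0 1 with hb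
  set c := γ 1 0 with hc
  set d := γ 1 1 with hd
  have hdet' : (a : ℚ) * d - b * c = 1 := by exact_mod_cast hdet
  simp only [rademacher, e]
  rw [← ha, ← hb, ← hc, ← hd]
  by_cases h0 : c = 0
  · have hu : IsUnit d := IsUnit.of_mul_eq_one a (by rw [h0] at hdet; linarith)
    have hd0 : d ≠ 0 := hu.ne_zero
    simp [h0, hd0, dedekindSum_zero_left]
  by_cases h1 : d = 0
  · simp only [h0, h1, dedekindSum_zero_left]
    simp
  have hcd : IsCoprime c d := ⟨-b, a, by linarith⟩
  have hrec := dedekindSum_reciprocity_int hcd h0 h1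
  rw [if_neg h1, if_neg h0, dedekindSum_neg]
  have n1 : (c : ℚ) ≠ 0 := by exact_mod_cast h0
  have n2 : (d : ℚ) ≠ 0 := by exact_mod_cast h1
  have key : ((b : ℚ) - c) / d - (a + d) / c + (c / d + d / c + 1 / (c * d)) = 0 := by
    field_simp
    linear_combination -hdet'
  push_cast
  linear_combination key + 12 * hrec

/-! ### A continuous logarithm of η and its behaviour under T and S -/

/-- The logarithm of the Dedekind eta function given by the logarithm of the product. -/
noncomputable def logEta (z : ℂ) : ℂ :=
  Real.pi * I * z / 12 + ∑' n : ℕ, log (1 - exp (2 * Real.pi * I * z) ^ (n + 1))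

lemma norm_log_one_sub_pow_le {q : ℂ} {r : ℝ} (hq : ‖q‖ ≤ r) (hr : r < 1) (n : ℕ) :
    ‖log (1 - q ^ (n + 1))‖ ≤ r ^ (n + 1) * ((1 - r)⁻¹ / 2 + 1) := by
  have hr0 : 0 ≤ r := (norm_nonneg q).trans hq
  have h1 : ‖-q ^ (n + 1)‖ ≤ r ^ (n + 1) := by
    rw [norm_neg, norm_pow]
    exact pow_le_pow_left₀ (norm_nonneg _) hq _
  have h2 : r ^ (n + 1) ≤ r := by
    rw [pow_succ]
    exact mul_le_of_le_one_left hr0 (pow_le_one₀ hr0 hr.le)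
  have h3 := norm_log_one_add_le (h1.trans_lt (h2.trans_lt hr))
  rw [sub_eq_add_neg]
  refine h3.trans ?_
  set x := ‖-q ^ (n + 1)‖
  have hx : 0 ≤ x := norm_nonneg _
  have h4 : (1 - x)⁻¹ ≤ (1 - r)⁻¹ := inv_anti₀ (by linarith) (by linarith)
  have h5 : 0 < (1 - r)⁻¹ := inv_pos.2 (by linarith)
  calc x ^ 2 * (1 - x)⁻¹ / 2 + x ≤ x * (1 - r)⁻¹ / 2 + x := by
        have : x ^ 2 ≤ x := by nlinarith
        have := mul_le_mul this h4 (inv_nonneg.2 (by linarith)) hx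
        linarith
    _ = x * ((1 - r)⁻¹ / 2 + 1) := by ring
    _ ≤ _ := by gcongr

lemma summable_pow_succ_mul {r : ℝ} (h0 : 0 ≤ r) (hr : r < 1) (C : ℝ) :
    Summable fun n : ℕ => r ^ (n + 1) * C :=
  ((summable_nat_add_iff 1).2 (summable_geometric_of_lt_one h0 hr)).mul_right C

lemma one_sub_pow_mem_slitPlane {q : ℂ} (hq : ‖q‖ < 1) (n : ℕ) : 1 - q ^ (n + 1) ∈ slitPlane := by
  rw [sub_eq_add_neg]
  apply mem_slitPlane_of_norm_lt_one
  rw [norm_neg, norm_pow]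
  exact pow_lt_one₀ (norm_nonneg _) hq (by omega)

lemma norm_exp_two_pi_I_mul_lt_one {z : ℂ} (hz : 0 < z.im) : ‖exp (2 * Real.pi * I * z)‖ < 1 :=
  UpperHalfPlane.norm_exp_two_pi_I_lt_one ⟨z, hz⟩

lemma continuousOn_tsum_log :
    ContinuousOn (fun q : ℂ => ∑' n : ℕ, log (1 - q ^ (n + 1))) (Metric.ball 0 1) := by
  intro q hq
  obtain ⟨r, hqr, hr⟩ := exists_between (mem_ball_zero_iff.1 hq)
  have h : ContinuousOn (fun q : ℂ => ∑' n : ℕ, log (1 - q ^ (n + 1))) (Metric.ball 0 r) := by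
    apply continuousOn_tsum (u := fun n : ℕ => r ^ (n + 1) * ((1 - r)⁻¹ / 2 + 1))
    · intro n
      refine ContinuousOn.clog (by fun_prop) fun x hx => one_sub_pow_mem_slitPlane ?_ n
      exact (mem_ball_zero_iff.1 hx).trans hr
    · exact summable_pow_succ_mul ((norm_nonneg _).trans hqr.le) hr _
    · intro n x hx
      exact norm_log_one_sub_pow_le (mem_ball_zero_iff.1 hx).le hr n
  exact (h.continuousAt (Metric.isOpen_ball.mem_nhds (mem_ball_zero_iff.2 hqr))).continuousWithinAt

lemma continuousOn_logEta : ContinuousOn logEta {z | 0 < z.im} := by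
  unfold logEta
  refine ContinuousOn.add (by fun_prop) ?_
  refine continuousOn_tsum_log.comp (f := fun z => exp (2 * Real.pi * I * z)) (by fun_prop) ?_
  exact fun z hz => mem_ball_zero_iff.2 (norm_exp_two_pi_I_mul_lt_one hz)

lemma exp_logEta {z : ℂ} (hz : 0 < z.im) : exp (logEta z) = ModularForm.eta z := by
  have hq := norm_exp_two_pi_I_mul_lt_one hz
  rw [logEta, exp_add, ModularForm.eta, cexp_tsum_eq_tprod]
  · congr 1
    · simp only [Function.Periodic.qParam]
      congr 1
      push_cast
      ring
    · simp only [ModularForm.eta_q_eq_pow]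
  · exact fun n => slitPlane_ne_zero (one_sub_pow_mem_slitPlane hq n)
  · exact Summable.of_norm_bounded (summable_pow_succ_mul (norm_nonneg _) hq _)
      fun n => norm_log_one_sub_pow_le le_rfl hq n

lemma logEta_add_one (z : ℂ) : logEta (z + 1) = logEta z + Real.pi * I / 12 := by
  have : exp (2 * Real.pi * I * (z + 1)) = exp (2 * Real.pi * I * z) := by
    rw [mul_add, mul_one, exp_add, exp_two_pi_mul_I, mul_one]
  rw [logEta, logEta, this]
  ring

/-- Two continuous functions on the upper half plane whose exponentials agree differ by a
constant. -/
lemma sub_eq_sub_of_exp_eq {f g : ℍ → ℂ} (hf : Continuous f) (hg : Continuous g)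
    (h : ∀ z, exp (f z) = exp (g z)) (z w : ℍ) : f z - g z = f w - g w := by
  -- The difference is 2πi times an integer that depends continuously on z, hence is constant by
  -- connectedness.
  choose n hn using fun z => exp_eq_exp_iff_exists_int.1 (h z)
  have hc : Continuous fun z => ((n z : ℤ) : ℝ) := by
    have : (fun z => ((n z : ℤ) : ℝ)) = fun z => ((f z - g z) / (2 * Real.pi * I)).re := by
      ext z
      have h2 : (2 * Real.pi * I : ℂ) ≠ 0 := two_pi_I_ne_zero
      rw [hn z, add_sub_cancel_left, mul_div_assoc, div_self h2, mul_one, ← ofReal_intCast,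
        ofReal_re]
    rw [this]
    fun_prop
  have hc' : Continuous n := Int.isClosedEmbedding_coe_real.isInducing.continuous_iff.2 hc
  rw [hn z, hn w, PreconnectedSpace.constant inferInstance hc' (x := z) (y := w)]
  ring

lemma log_div_I {z : ℂ} (hz : 0 < z.im) : log (z / I) = log z - Real.pi / 2 * I := by
  have hz0 : z ≠ 0 := fun h => by simp [h] at hz
  apply eq_of_exp_eq_of_abs_im_sub_lt
  · rw [exp_sub, exp_log hz0, exp_log (div_ne_zero hz0 I_ne_zero), exp_pi_div_two_mul_I]
  · have h1 := abs_lt.1 ((abs_arg_lt_pi_div_two_iff (z := z / I)).2 (.inl (by rwa [div_I_re])))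
    have h2 := arg_lt_pi_iff.2 (.inr hz.ne')
    have h3 := arg_nonneg_iff.2 hz.le
    have h4 : ((Real.pi : ℂ) / 2 * I).im = Real.pi / 2 := by simp
    rw [sub_im, sub_im, log_im, log_im, h4, abs_lt]
    constructor <;> linarith [Real.pi_pos]

/-- Both sides are continuous logarithms of η(-1/z), so they differ by a constant. That constant is
0 because i is fixed by z ↦ -1/z and log(i/i) = 0. -/
lemma logEta_S (z : ℍ) : logEta (-1 / (z : ℂ)) = logEta z + log (z / I) / 2 := by
  have him : ∀ z : ℍ, 0 < (-1 / (z : ℂ)).im := by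
    intro z
    rw [neg_div, one_div]
    exact UpperHalfPlane.im_inv_neg_coe_pos z |>.trans_eq (by simp [inv_neg])
  have hre : ∀ z : ℍ, 0 < ((z : ℂ) / I).re := fun z => by
    rw [div_I_re]; exact z.im_pos
  have hf : Continuous fun z : ℍ => logEta (-1 / (z : ℂ)) := by
    refine continuousOn_logEta.comp_continuous ?_ him
    exact continuous_const.div UpperHalfPlane.continuous_coe fun z => z.ne_zero
  have hg : Continuous fun z : ℍ => logEta z + log (z / I) / 2 := by
    refine (continuousOn_logEta.comp_continuous UpperHalfPlane.continuous_coe fun z => z.im_pos).add ?_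
    refine Continuous.div_const (Continuous.clog ?_ fun z => .inl (hre z)) 2
    exact UpperHalfPlane.continuous_coe.div_const _
  have hexp : ∀ z : ℍ, exp (logEta (-1 / (z : ℂ))) = exp (logEta z + log (z / I) / 2) := by
    intro z
    rw [exp_logEta (him z), exp_add, exp_logEta z.im_pos]
    have hS : ModularForm.eta (-1 / (z : ℂ)) = (sqrt I)⁻¹ * (sqrt z * ModularForm.eta z) :=
      ModularForm.eta_comp_eq_csqrt_I_inv z.2
    rw [hS, sqrt_eq_exp I_ne_zero, sqrt_eq_exp z.ne_zero, ← exp_neg, ← mul_assoc, ← exp_add,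
      mul_comm, log_div_I z.im_pos, log_I]
    congr 2
    ring
  have hI := sub_eq_sub_of_exp_eq hf hg hexp z UpperHalfPlane.I
  have e1 : -1 / I = I := by rw [neg_div, one_div, inv_I, neg_neg]
  rw [UpperHalfPlane.coe_I, e1, div_self I_ne_zero, log_one, zero_div, add_zero, sub_self] at hI
  exact sub_eq_zero.1 hI

/-! ### The transformation formula on SL(2, ℤ) -/

lemma sign_im_mul_add {z : ℂ} (hz : 0 < z.im) (c d : ℝ) :
    SignType.sign ((c : ℂ) * z + d).im = SignType.sign c := by
  have : ((c : ℂ) * z + d).im = c * z.im := by simp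
  rw [this, sign_mul, sign_pos hz, mul_one]

/-- The transformation formula of `log η` under `γ`. -/
def LogEtaTransforms (γ : SL(2, ℤ)) : Prop :=
  ∀ z : ℍ, logEta (γ • z : ℍ) = logEta z + 1 / 2 * autLog ((γ 1 0 : ℂ) * z + γ 1 1)
    + Real.pi * I / 12 * rademacher γ

/-- The equivalence, rather than one implication, also handles right multiplication by T⁻¹. -/
lemma logEtaTransforms_mul_T (γ : SL(2, ℤ)) :
    LogEtaTransforms (γ * T) ↔ LogEtaTransforms γ := by
  have e : (γ * T) 1 0 = γ 1 0 ∧ (γ * T) 1 1 = γ 1 0 + γ 1 1 := by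
    rw [Matrix.SpecialLinearGroup.coe_mul]
    simp [T, Matrix.mul_apply, Fin.sum_univ_two]
  have key : ∀ z : ℍ, (logEta ((γ * T) • z : ℍ) = logEta z
        + 1 / 2 * autLog (((γ * T) 1 0 : ℂ) * z + (γ * T) 1 1)
        + Real.pi * I / 12 * rademacher (γ * T)) ↔
      (logEta (γ • (T • z) : ℍ) = logEta (T • z : ℍ)
        + 1 / 2 * autLog ((γ 1 0 : ℂ) * (T • z : ℍ) + γ 1 1)
        + Real.pi * I / 12 * rademacher γ) := by
    intro z
    have hT : ((T • z : ℍ) : ℂ) = z + 1 := by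
      rw [UpperHalfPlane.modular_T_smul, UpperHalfPlane.coe_vadd]
      push_cast
      ring
    rw [rademacher_mul_T, e.1, e.2, mul_smul, hT, logEta_add_one]
    push_cast
    rw [show (γ 1 0 : ℂ) * (z + 1) + γ 1 1 = γ 1 0 * z + (γ 1 0 + γ 1 1) by ring]
    constructor <;> intro h <;> rw [h] <;> ring
  constructor
  · intro h z
    have := (key (T⁻¹ • z)).1 (h _)
    rwa [smul_inv_smul] at this
  · exact fun h z => (key z).2 (h _)

/-- With u = c(-1/z) + d and v = z, the product uv = dz - c is the automorphy factor of γS. Half the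
sign term of `autLog_mul` is (πi/4) sgn(c) sgn(d), which offsets the change of `rademacher` by -3
sgn(c) sgn(d). -/
lemma logEtaTransforms_mul_S {γ : SL(2, ℤ)} (h : LogEtaTransforms γ) :
    LogEtaTransforms (γ * S) := by
  intro z
  have e : (γ * S) 1 0 = γ 1 1 ∧ (γ * S) 1 1 = -γ 1 0 := by
    rw [Matrix.SpecialLinearGroup.coe_mul]
    simp [S, Matrix.mul_apply, Fin.sum_univ_two]
  have hS : ((S • z : ℍ) : ℂ) = -1 / z := by
    rw [UpperHalfPlane.modular_S_smul]
    simp [neg_div]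
  have hdet := γ.det_coe
  rw [Matrix.det_fin_two] at hdet
  have hunit : ∀ m n : ℤ, m * n = 1 → ((n : ℂ) = 1 ∨ (n : ℂ) = -1) := by
    intro m n hmn
    rcases Int.mul_eq_one_iff_eq_one_or_neg_one.1 hmn with ⟨h1, h2⟩ | ⟨h1, h2⟩
    · left; exact_mod_cast h2
    · right; exact_mod_cast h2
  have hs1 : SignType.sign ((γ 1 0 : ℂ) * (S • z : ℍ) + γ 1 1).im = SignType.sign (γ 1 0 : ℝ) := by
    exact_mod_cast sign_im_mul_add (S • z).im_pos (γ 1 0) (γ 1 1)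
  have hs2 : SignType.sign ((γ 1 1 : ℂ) * z + -γ 1 0).im = SignType.sign (γ 1 1 : ℝ) := by
    exact_mod_cast sign_im_mul_add z.im_pos (γ 1 1) (-γ 1 0)
  have huv : ((γ 1 0 : ℂ) * (S • z : ℍ) + γ 1 1) * z = (γ 1 1 : ℂ) * z + -γ 1 0 := by
    have := z.ne_zero
    rw [hS]
    field_simp
    ring
  have hcast : ∀ n : ℤ, ((SignType.sign (n : ℝ) : ℝ) : ℂ) = n.sign := by
    intro n
    rcases lt_trichotomy n 0 with hn | rfl | hn
    · have : (n : ℝ) < 0 := by exact_mod_cast hn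
      simp [this, Int.sign_eq_neg_one_of_neg hn]
    · simp
    · have : (0 : ℝ) < n := by exact_mod_cast hn
      simp [this, Int.sign_eq_one_of_pos hn]
  have hz0 : (z : ℂ).im ≠ 0 := z.im_pos.ne'
  have hmul := autLog_mul (u := (γ 1 0 : ℂ) * (S • z : ℍ) + γ 1 1) (v := z) ?_
    (fun h => absurd h hz0) ?_
  · rw [huv, hs1, hs2, sign_pos (show 0 < (z : ℂ).im from z.im_pos), hcast, hcast,
      autLog_of_im_pos (show 0 < (z : ℂ).im from z.im_pos)] at hmul
    have h1 := h (S • z)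
    rw [mul_smul, h1, e.1, e.2, rademacher_mul_S]
    push_cast
    rw [hmul, hS, logEta_S]
    simp only [SignType.coe_one, ofReal_one]
    ring
  · intro h0
    have h1 : γ 1 0 = 0 := by
      rw [← sign_eq_zero_iff, hs1, sign_eq_zero_iff] at h0
      exact_mod_cast h0
    rw [h1] at hdet ⊢
    simpa using hunit _ _ (by linarith : γ 0 0 * γ 1 1 = 1)
  · rw [huv]
    intro h0
    have h1 : γ 1 1 = 0 := by
      rw [← sign_eq_zero_iff, hs2, sign_eq_zero_iff] at h0
      exact_mod_cast h0
    rw [h1] at hdet ⊢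
    simpa using hunit (γ 0 1) (-γ 1 0) (by linarith)

theorem logEtaTransforms (γ : SL(2, ℤ)) : LogEtaTransforms γ := by
  have hγ : γ ∈ Subgroup.closure {S, T} := by
    simp [SpecialLinearGroup.SL2Z_generators]
  induction hγ using Subgroup.closure_induction_right with
  | one =>
    intro z
    have h1 : rademacher 1 = 0 := by simp [rademacher]
    rw [one_smul, h1, autLog_of_im_eq_zero (by simp)]
    simp
  | mul_right x _ y hy ih =>
    rcases hy with rfl | rfl
    · exact logEtaTransforms_mul_S ih
    · exact (logEtaTransforms_mul_T x).2 ih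
  | mul_inv_cancel x _ y hy ih =>
    rcases hy with rfl | rfl
    -- S has order 4, so the forward step for S is enough.
    · have : x * S⁻¹ = x * S * S * S := by
        rw [mul_inv_eq_iff_eq_mul]
        have h4 : S * S * S * S = 1 := by decide
        simp only [mul_assoc] at h4 ⊢
        rw [h4, mul_one]
      rw [this]
      exact logEtaTransforms_mul_S (logEtaTransforms_mul_S (logEtaTransforms_mul_S ih))
    · rw [← logEtaTransforms_mul_T, inv_mul_cancel_right]
      exact ih


/-! ### The normalizer of Γ₀(p) -/

lemma mem_Gamma0Real_iff {p : ℕ} {γ : SL(2, ℝ)} :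
    γ ∈ Gamma0Real p ↔ ∃ g : CongruenceSubgroup.Gamma0 p,
      g.1.1.map (Int.cast : ℤ → ℝ) = (γ : Matrix (Fin 2) (Fin 2) ℝ) := by
  constructor
  · rintro ⟨g, hg, rfl⟩
    exact ⟨⟨g, hg⟩, rfl⟩
  · rintro ⟨g, hg⟩
    exact ⟨g.1, g.2, Subtype.ext hg⟩

lemma exists_int_of_mem_Gamma0Real {p : ℕ} {γ : SL(2, ℝ)} (h : γ ∈ Gamma0Real p) :
    ∃ a b c d : ℤ, γ 0 0 = a ∧ γ 0 1 = b ∧ γ 1 0 = p * c ∧ γ 1 1 = d := by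
  obtain ⟨g, hg⟩ := mem_Gamma0Real_iff.1 h
  obtain ⟨c, hc⟩ := (ZMod.intCast_zmod_eq_zero_iff_dvd _ p).1 (CongruenceSubgroup.Gamma0_mem.1 g.2)
  refine ⟨g.1 0 0, g.1 0 1, c, g.1 1 1, ?_, ?_, ?_, ?_⟩
  · rw [← hg]; rfl
  · rw [← hg]; rfl
  · rw [← hg]
    have : ((g.1 1 0 : ℤ) : ℝ) = ((p * c : ℤ) : ℝ) := by rw [hc]
    push_cast at this
    exact this
  · rw [← hg]; rfl

lemma mem_Gamma0Real_of_int {p : ℕ} {γ : SL(2, ℝ)} {a b c d : ℤ} (ha : γ 0 0 = a) (hb : γ 0 1 = b)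
    (hc : γ 1 0 = p * c) (hd : γ 1 1 = d) : γ ∈ Gamma0Real p := by
  have hdet := γ.det_coe
  rw [Matrix.det_fin_two, ha, hb, hc, hd] at hdet
  have hdet' : a * d - b * (p * c) = 1 := by exact_mod_cast hdet
  refine mem_Gamma0Real_iff.2 ⟨⟨⟨!![a, b; p * c, d], by rw [Matrix.det_fin_two_of]; exact hdet'⟩,
    ?_⟩, ?_⟩
  · refine CongruenceSubgroup.Gamma0_mem.2 ?_
    change ((p * c : ℤ) : ZMod p) = 0
    simp
  · ext i j
    fin_cases i <;> fin_cases j <;> simp [ha, hb, hc, hd]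

/-- Integrality forced by conjugating the two standard parabolic elements into `Γ₀(p)`. -/
lemma exists_int_of_conj_mem {p : ℕ} (hp : 0 < p) {γ : SL(2, ℝ)}
    (h : ∀ x ∈ Gamma0Real p, γ * x * γ⁻¹ ∈ Gamma0Real p) :
    (∃ A k C : ℤ, γ 0 0 ^ 2 = A ∧ γ 0 0 * γ 1 0 = k ∧ γ 1 0 ^ 2 = p * C) ∧
      ∃ B m D : ℤ, p * γ 0 1 ^ 2 = B ∧ p * γ 0 1 * γ 1 1 = m ∧ γ 1 1 ^ 2 = D := by
  have hp0 : (p : ℝ) ≠ 0 := by positivity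
  have hdet := γ.det_coe
  rw [Matrix.det_fin_two] at hdet
  constructor
  -- The conjugate is (1 - ac, a²; -c², 1 + ac).
  · let x : SL(2, ℝ) := ⟨!![1, 1; 0, 1], by simp⟩
    have hx : x ∈ Gamma0Real p :=
      mem_Gamma0Real_of_int (a := 1) (b := 1) (c := 0) (d := 1) (by simp [x]) (by simp [x])
        (by simp [x]) (by simp [x])
    obtain ⟨n₁, n₂, n₃, n₄, h₁, h₂, h₃, h₄⟩ := exists_int_of_mem_Gamma0Real (h x hx)
    simp only [Matrix.SpecialLinearGroup.coe_mul, Matrix.SpecialLinearGroup.coe_inv,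
      Matrix.mul_apply, Fin.sum_univ_two, Matrix.adjugate_fin_two] at h₁ h₂ h₃ h₄
    simp [x] at h₁ h₂ h₃ h₄
    refine ⟨n₂, 1 - n₁, -n₃, ?_, ?_, ?_⟩
    · linear_combination h₂
    · push_cast
      linear_combination hdet - h₁
    · push_cast
      linear_combination -h₃
  -- The conjugate is (1 + pbd, -pb²; pd², 1 - pbd).
  · let x : SL(2, ℝ) := ⟨!![1, 0; p, 1], by simp⟩
    have hx : x ∈ Gamma0Real p :=
      mem_Gamma0Real_of_int (a := 1) (b := 0) (c := 1) (d := 1) (by simp [x]) (by simp [x])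
        (by simp [x]) (by simp [x])
    obtain ⟨n₁, n₂, n₃, n₄, h₁, h₂, h₃, h₄⟩ := exists_int_of_mem_Gamma0Real (h x hx)
    simp only [Matrix.SpecialLinearGroup.coe_mul, Matrix.SpecialLinearGroup.coe_inv,
      Matrix.mul_apply, Fin.sum_univ_two, Matrix.adjugate_fin_two] at h₁ h₂ h₃ h₄
    simp [x] at h₁ h₂ h₃ h₄
    refine ⟨-n₂, n₁ - 1, n₃, ?_, ?_, ?_⟩
    · push_cast
      linear_combination -h₂
    · push_cast
      linear_combination h₁ - hdet
    · apply mul_left_cancel₀ hp0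
      linear_combination h₃

/-- Real numbers whose pairwise products are integers are integral multiples of one square root
of an integer. -/
lemma exists_common_generator {ι : Type*} [Fintype ι] (y : ι → ℝ) {i₀ : ι} (h0 : y i₀ ≠ 0)
    (h : ∀ i j, ∃ n : ℤ, y i * y j = n) :
    ∃ (E : ℕ) (t : ι → ℤ), ∀ i, y i = √E * t i := by
  choose N hN using h
  obtain ⟨G, hG⟩ := (inferInstance : (Ideal.span (Set.range (N i₀))).IsPrincipal).principal
  have ht : ∀ j, ∃ t : ℤ, N i₀ j = G * t := fun j => by
    have : N i₀ j ∈ Ideal.span (Set.range (N i₀)) := Ideal.subset_span ⟨j, rfl⟩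
    rw [hG] at this
    exact Ideal.mem_span_singleton.1 this
  choose t ht using ht
  obtain ⟨s, hs⟩ : ∃ s : ι → ℤ, ∑ j, s j * N i₀ j = G := by
    have : G ∈ Ideal.span (Set.range (N i₀)) := by
      rw [hG]; exact Ideal.mem_span_singleton_self G
    exact (Ideal.mem_span_range_iff_exists_fun).1 this
  -- With G a generator of the ideal of the integers y_{i₀} y_j, Bézout coefficients give e with
  -- y_{i₀} e = G. Hence every y_j is an integer multiple of e, and e² is an integer because it is
  -- an integral combination of products.
  set e : ℝ := ∑ j, s j * y j with he
  have h1 : y i₀ * e = G := by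
    rw [← hs, he, Finset.mul_sum]
    push_cast
    refine Finset.sum_congr rfl fun j _ => ?_
    rw [← hN]
    ring
  have h2 : ∀ j, y j = e * t j := fun j => by
    apply mul_left_cancel₀ h0
    rw [hN, ht, ← mul_assoc, h1]
    push_cast
    rfl
  have h3 : e ^ 2 = ((∑ i, ∑ j, s i * s j * N i j : ℤ) : ℝ) := by
    rw [pow_two, he, Finset.sum_mul_sum]
    push_cast
    refine Finset.sum_congr rfl fun i _ => Finset.sum_congr rfl fun j _ => ?_
    rw [← hN]
    ring
  set E := ∑ i, ∑ j, s i * s j * N i j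
  have hE : 0 ≤ E := by
    have : (0 : ℝ) ≤ E := h3 ▸ sq_nonneg e
    exact_mod_cast this
  have hE' : ((E.toNat : ℕ) : ℝ) = e ^ 2 := by
    rw [h3, ← Int.cast_natCast, Int.toNat_of_nonneg hE]
  rcases le_total 0 e with h4 | h4
  · refine ⟨E.toNat, t, fun i => ?_⟩
    rw [hE', Real.sqrt_sq h4, h2]
  · refine ⟨E.toNat, fun i => -t i, fun i => ?_⟩
    rw [hE', Real.sqrt_sq_eq_abs, abs_of_nonpos h4, h2]
    push_cast
    ring

lemma exists_int_of_two_mul_of_sq {x : ℝ} {m n : ℤ} (h1 : 2 * x = m) (h2 : x ^ 2 = n) :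
    ∃ k : ℤ, x = k := by
  have h : m ^ 2 = 4 * n := by
    have : (m : ℝ) ^ 2 = 4 * n := by rw [← h1, ← h2]; ring
    exact_mod_cast this
  have h3 : (2 : ℤ) ∣ m := Int.prime_two.dvd_of_dvd_pow (n := 2) ⟨2 * n, by rw [h]; ring⟩
  obtain ⟨k, rfl⟩ := h3
  refine ⟨k, ?_⟩
  push_cast at h1
  linarith

lemma dvd_of_cast_sq {p : ℕ} (hp : p.Prime) {m n : ℤ} (h : (m : ℝ) ^ 2 = p * n) : (p : ℤ) ∣ m := by
  have h' : m ^ 2 = p * n := by exact_mod_cast h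
  exact (Nat.prime_iff_prime_int.1 hp).dvd_of_dvd_pow ⟨n, h'⟩

/-- The normalizer of `Γ₀(p)` consists of `Γ₀(p)` and its Fricke coset. -/
theorem mem_Gamma0Plus_cases {p : ℕ} (hp : p.Prime) {γ : SL(2, ℝ)} (hγ : γ ∈ Gamma0Plus p) :
    (∃ g : CongruenceSubgroup.Gamma0 p,
      g.1.1.map (Int.cast : ℤ → ℝ) = (γ : Matrix (Fin 2) (Fin 2) ℝ)) ∨
    ∃ g : CongruenceSubgroup.Gamma0 p, g.1.1.map (Int.cast : ℤ → ℝ) = frickeTwist p γ := by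
  have hpp : (0 : ℝ) < p := by exact_mod_cast hp.pos
  have hp0 : (p : ℝ) ≠ 0 := hpp.ne'
  have hdet := γ.det_coe
  rw [Matrix.det_fin_two] at hdet
  -- The inverse supplies the integrality of cd and pab, which γ itself does not give.
  have hγ' := inv_mem hγ
  obtain ⟨⟨A, k, C, hA, hk, hC⟩, B, m, D, hB, hm, hD⟩ := exists_int_of_conj_mem hp.pos
    fun x hx => (Subgroup.mem_normalizer_iff.1 hγ x).1 hx
  obtain ⟨⟨-, k', -, -, hk', -⟩, -, m', -, -, hm', -⟩ := exists_int_of_conj_mem hp.pos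
    fun x hx => (Subgroup.mem_normalizer_iff.1 hγ' x).1 hx
  simp [Matrix.SpecialLinearGroup.coe_inv, Matrix.adjugate_fin_two] at hk' hm'
  set a := γ 0 0 with ha
  set b := γ 0 1 with hb
  set c := γ 1 0 with hc
  set d := γ 1 1 with hd
  have hbc2 : (b * c) ^ 2 = ((B * C : ℤ) : ℝ) := by
    push_cast
    rw [← hB]
    linear_combination b ^ 2 * hC
  have had2 : (a * d) ^ 2 = ((A * D : ℤ) : ℝ) := by
    push_cast
    rw [← hA, ← hD]
    ring
  have had : a * d = 1 + b * c := by linarith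
  obtain ⟨n, hn⟩ : ∃ n : ℤ, b * c = n := by
    refine exists_int_of_two_mul_of_sq (m := A * D - 1 - B * C) ?_ hbc2
    push_cast at had2 hbc2 ⊢
    rw [← had2, ← hbc2, had]
    ring
  have hprod : ∀ i j : Fin 4, ∃ N : ℤ, ![a, d, c, p * b] i * ![a, d, c, p * b] j = N := by
    have h00 : ∃ N : ℤ, a * a = N := ⟨A, by rw [← hA]; ring⟩
    have h01 : ∃ N : ℤ, a * d = N := ⟨1 + n, by rw [had, hn]; push_cast; rfl⟩
    have h02 : ∃ N : ℤ, a * c = N := ⟨k, hk⟩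
    have h03 : ∃ N : ℤ, a * (p * b) = N := ⟨-m', by push_cast; rw [← hm']; ring⟩
    have h11 : ∃ N : ℤ, d * d = N := ⟨D, by rw [← hD]; ring⟩
    have h12 : ∃ N : ℤ, d * c = N := ⟨-k', by push_cast; rw [← hk']; ring⟩
    have h13 : ∃ N : ℤ, d * (p * b) = N := ⟨m, by rw [← hm]; ring⟩
    have h22 : ∃ N : ℤ, c * c = N := ⟨p * C, by push_cast; rw [← hC]; ring⟩
    have h23 : ∃ N : ℤ, c * (p * b) = N := ⟨p * n, by push_cast; rw [← hn]; ring⟩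
    have h33 : ∃ N : ℤ, (p * b) * (p * b) = N := ⟨p * B, by push_cast; rw [← hB]; ring⟩
    intro i j
    wlog hij : i ≤ j generalizing i j
    · obtain ⟨N, hN⟩ := this j i (le_of_not_ge hij)
      exact ⟨N, by rw [mul_comm, hN]⟩
    fin_cases i <;> fin_cases j <;> first | assumption | exact absurd hij (by decide)
  obtain ⟨i₀, hi₀⟩ : ∃ i, ![a, d, c, p * b] i ≠ 0 := by
    by_contra! h
    have e1 := h 0
    have e2 := h 2
    simp at e1 e2
    rw [e1, e2] at hdet
    simp at hdet
  obtain ⟨E, t, ht⟩ := exists_common_generator _ hi₀ hprod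
  have t0 : a = √E * t 0 := ht 0
  have t1 : d = √E * t 1 := ht 1
  have t2 : c = √E * t 2 := ht 2
  have t3 : p * b = √E * t 3 := ht 3
  have hsq : √(E : ℝ) * √E = E := Real.mul_self_sqrt (by positivity)
  -- Multiplying the determinant by p gives p = E(p t₀t₁ - t₂t₃), so E is 1 or p: the first puts γ
  -- in Γ₀(p), the second makes the Fricke twist integral.
  have hEp : E ∣ p := by
    have : (p : ℝ) = E * (p * t 0 * t 1 - t 2 * t 3) := by
      calc (p : ℝ) = p * a * d - c * (p * b) := by linear_combination -(p : ℝ) * hdet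
        _ = _ := by
          rw [t3, t0, t1, t2]
          linear_combination (p * t 0 * t 1 - t 2 * t 3 : ℝ) * hsq
    exact Int.natCast_dvd_natCast.1 ⟨p * t 0 * t 1 - t 2 * t 3, by exact_mod_cast this⟩
  rcases (Nat.dvd_prime hp).1 hEp with rfl | rfl
  · left
    simp only [Nat.cast_one, Real.sqrt_one, one_mul] at t0 t1 t2 t3
    obtain ⟨c', hc'⟩ := dvd_of_cast_sq hp (m := t 2) (n := C) (by rw [← t2, hC])
    obtain ⟨b', hb'⟩ := dvd_of_cast_sq hp (m := t 3) (n := B) (by rw [← t3, ← hB]; ring)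
    refine mem_Gamma0Real_iff.1 (mem_Gamma0Real_of_int (a := t 0) (b := b') (c := c') (d := t 1)
      t0 ?_ ?_ t1)
    · apply mul_left_cancel₀ hp0
      rw [← hb, t3, hb']
      push_cast
      rfl
    · rw [← hc, t2, hc']
      push_cast
      rfl
  · right
    have hs0 : √(E : ℝ) ≠ 0 := by positivity
    have e1 : 1 / √(E : ℝ) * c = t 2 := by rw [t2]; field_simp
    have e2 : 1 / √(E : ℝ) * d = t 1 := by rw [t1]; field_simp
    have e3 : 1 / √(E : ℝ) * (-E * a) = -E * t 0 := by rw [t0]; field_simp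
    have e4 : 1 / √(E : ℝ) * (-E * b) = -t 3 := by rw [neg_mul, t3]; field_simp
    have hdet' : t 2 * -t 3 - t 1 * (-E * t 0) = 1 := by
      have : (t 2 : ℝ) * -t 3 - t 1 * (-E * t 0) = 1 := by
        rw [← e1, ← e2, ← e3, ← e4]
        field_simp
        rw [pow_two, hsq]
        linear_combination (E : ℝ) * hdet
      exact_mod_cast this
    refine ⟨⟨⟨!![t 2, t 1; -E * t 0, -t 3], by rw [Matrix.det_fin_two_of]; exact hdet'⟩, ?_⟩, ?_⟩
    · refine CongruenceSubgroup.Gamma0_mem.2 ?_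
      change ((-E * t 0 : ℤ) : ZMod E) = 0
      simp
    · rw [frickeTwist]
      ext i j
      fin_cases i <;> fin_cases j
      · simpa using e1.symm
      · simpa using e2.symm
      · simpa using e3.symm
      · simpa using e4.symm


/-! ### The logarithm of η_p and its transformation on Γ₀⁺(p) -/

lemma im_natCast_mul_pos {p : ℕ} (hp : 0 < p) (z : ℍ) : 0 < ((p : ℂ) * z).im := by
  have : ((p : ℂ) * z).im = p * z.im := by simp
  rw [this]
  have := z.im_pos
  positivity

/-- A continuous logarithm of `η(z)^{1/2} η(pz)^{1/2}`. -/
noncomputable def logEtaP (p : ℕ) (z : ℍ) : ℂ := (logEta z + logEta (p * z)) / 2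

lemma continuous_logEtaP {p : ℕ} (hp : 0 < p) : Continuous (logEtaP p) := by
  refine Continuous.div_const (Continuous.add ?_ ?_) 2
  · exact continuousOn_logEta.comp_continuous UpperHalfPlane.continuous_coe fun z => z.im_pos
  · exact continuousOn_logEta.comp_continuous
      (continuous_const.mul UpperHalfPlane.continuous_coe) (im_natCast_mul_pos hp)

lemma exp_logEtaP_pow {p : ℕ} (hp : 0 < p) (k : ℕ) (z : ℍ) :
    exp (logEtaP p z) ^ (2 * k) = deltaP p k z := by
  rw [deltaP, ← exp_logEta z.im_pos, ← exp_logEta (im_natCast_mul_pos hp z), ← mul_pow, ← exp_add,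
    pow_mul, ← exp_nat_mul, logEtaP]
  congr 2
  push_cast
  ring

/-- At z = iy the nome is a real number in (0, 1), so every term of the series is real. -/
lemma logEta_im_eq_zero {z : ℂ} (hz : 0 < z.im) (hre : z.re = 0) : (logEta z).im = 0 := by
  set y : ℝ := z.im
  have hzy : z = I * y := by
    apply Complex.ext <;> simp [hre, y]
  set q : ℝ := Real.exp (-(2 * Real.pi * y))
  have hq : exp (2 * Real.pi * I * z) = (q : ℂ) := by
    rw [hzy, ofReal_exp]
    congr 1
    push_cast
    linear_combination 2 * Real.pi * y * I_sq
  have hq1 : q < 1 := Real.exp_lt_one_iff.2 (by have := mul_pos Real.pi_pos hz; change -(2 * Real.pi * z.im) < 0; linarith)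
  have h : logEta z = ((-(Real.pi * y / 12) + ∑' n : ℕ, Real.log (1 - q ^ (n + 1)) : ℝ) : ℂ) := by
    rw [logEta, hq, hzy]
    push_cast
    congr 1
    · linear_combination Real.pi * y / 12 * I_sq
    · refine tsum_congr fun n => ?_
      have : (0 : ℝ) ≤ 1 - q ^ (n + 1) := sub_nonneg.2 (pow_le_one₀ (Real.exp_pos _).le hq1.le)
      rw [ofReal_log this]
      push_cast
      rfl
  rw [h, ofReal_im]

lemma logEtaP_im_eq_zero {p : ℕ} (hp : 0 < p) {z : ℍ} (hre : z.re = 0) : (logEtaP p z).im = 0 := by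
  have h1 := logEta_im_eq_zero z.im_pos hre
  have h2 := logEta_im_eq_zero (im_natCast_mul_pos hp z) (by
    simp [hre])
  have : logEtaP p z = ((1 / 2 : ℝ) : ℂ) * (logEta z + logEta (p * z)) := by
    rw [logEtaP]; push_cast; ring
  rw [this, im_ofReal_mul, add_im, h1, h2, add_zero, mul_zero]

lemma coe_smul_eq {R : Type*} [CommRing R] [Algebra R ℝ] (g : SL(2, R)) (z : ℍ) :
    ((g • z : ℍ) : ℂ) = ((algebraMap R ℝ (g 0 0) : ℂ) * z + (algebraMap R ℝ (g 0 1) : ℂ)) /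
      ((algebraMap R ℝ (g 1 0) : ℂ) * z + (algebraMap R ℝ (g 1 1) : ℂ)) :=
  UpperHalfPlane.coe_specialLinearGroup_apply g z

/-- The transformation formula of `logEtaP` on `Γ₀(p)`. -/
lemma logEtaP_Gamma0_smul {p : ℕ} (hp : 0 < p) (g : CongruenceSubgroup.Gamma0 p) (z : ℍ) :
    logEtaP p (g.1 • z) = logEtaP p z + 1 / 2 * autLog ((g.1 1 0 : ℂ) * z + g.1 1 1)
      + Real.pi * I / 12 * rademacherGamma0 p g := by
  have hpp : (p : ℂ) ≠ 0 := by exact_mod_cast hp.ne'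
  obtain ⟨c, hc⟩ := (ZMod.intCast_zmod_eq_zero_iff_dvd _ p).1 (CongruenceSubgroup.Gamma0_mem.1 g.2)
  let w : ℍ := ⟨p * z, im_natCast_mul_pos hp z⟩
  have e00 : companion p g 0 0 = g.1 0 0 := rfl
  have e01 : companion p g 0 1 = p * g.1 0 1 := rfl
  have e10 : companion p g 1 0 = c := by
    change g.1 1 0 / p = c
    rw [hc]
    exact Int.mul_ediv_cancel_left _ (by exact_mod_cast hp.ne')
  have e11 : companion p g 1 1 = g.1 1 1 := rfl
  -- The companion is the conjugate of g by z ↦ pz: it sends pz to p·g(z), and its factor (c/p)(pz)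
  -- + d is that of g.
  have hw : ((companion p g • w : ℍ) : ℂ) = p * (g.1 • z : ℍ) := by
    rw [coe_smul_eq, coe_smul_eq, e00, e01, e10, e11, hc]
    simp only [eq_intCast, w]
    push_cast
    rw [mul_div_assoc']
    congr 1 <;> ring
  have h1 := logEtaTransforms g.1 z
  have h2 := logEtaTransforms (companion p g) w
  have harg : ((companion p g 1 0 : ℤ) : ℂ) * (w : ℂ) + (companion p g 1 1 : ℤ) =
      (g.1 1 0 : ℂ) * z + g.1 1 1 := by
    rw [e10, e11, hc]
    simp only [w]
    push_cast
    ring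
  rw [hw, harg] at h2
  simp only [w] at h2
  rw [logEtaP, logEtaP, h1, h2, rademacherGamma0]
  push_cast
  ring

/-- The transformation formula of `logEtaP` under the Fricke involution. -/
lemma logEtaP_fricke {p : ℕ} (hp : 0 < p) {z w : ℍ} (hw : (w : ℂ) = -1 / (p * z)) :
    logEtaP p w = logEtaP p z + 1 / 2 * autLog (√(p : ℝ) * z) := by
  have hpp : (p : ℂ) ≠ 0 := by exact_mod_cast hp.ne'
  have hs : 0 < √(p : ℝ) := by positivity
  have hz0 := z.ne_zero
  let z' : ℍ := ⟨p * z, im_natCast_mul_pos hp z⟩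
  have h1 := logEta_S z
  have h2 := logEta_S z'
  have hz' : (z' : ℂ) = p * z := rfl
  have hwp : p * (w : ℂ) = -1 / z := by rw [hw]; field_simp
  have him : ((√(p : ℝ) : ℂ) * z).im = √p * z.im := by rw [im_ofReal_mul]; rfl
  -- Averaging the inversion formula at z and pz gives (log(z/i) + log(pz/i))/4, which equals log(√p
  -- z/i)/2 because positive reals split off.
  have hlog : ∀ r : ℝ, 0 < r → log ((r : ℂ) * z / I) = Real.log r + log (z / I) := fun r hr => by
    rw [mul_div_assoc, log_ofReal_mul hr (div_ne_zero hz0 I_ne_zero)]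
  have hp2 := hlog p (by exact_mod_cast hp)
  rw [hz', show (p : ℂ) * z / I = ((p : ℝ) : ℂ) * z / I by push_cast; rfl, hp2] at h2
  rw [logEtaP, logEtaP, hwp, hw, h1, h2, autLog_of_im_pos (by rw [him]; exact mul_pos hs z.im_pos),
    hlog _ hs, Real.log_sqrt (by positivity)]
  push_cast
  ring

lemma exists_smul_eq_smul {γ : SL(2, ℝ)} {g : SL(2, ℤ)}
    (h : g.1.map (Int.cast : ℤ → ℝ) = (γ : Matrix (Fin 2) (Fin 2) ℝ)) (z : ℍ) : γ • z = g • z := by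
  have : γ = Matrix.SpecialLinearGroup.map (Int.castRingHom ℝ) g := Subtype.ext h.symm
  subst this
  rfl

/-- The transformation formula of `logEtaP` on `Γ₀⁺(p)`. -/
theorem logEtaP_smul {p : ℕ} (hp : p.Prime) {γ : SL(2, ℝ)} (hγ : γ ∈ Gamma0Plus p) (z : ℍ) :
    logEtaP p (γ • z) = logEtaP p z + 1 / 2 * autLog ((γ 1 0 : ℂ) * z + γ 1 1)
      + Real.pi * I / 12 * rademacherP p γ := by
  by_cases h1 : ∃ g : CongruenceSubgroup.Gamma0 p,
      g.1.1.map (Int.cast : ℤ → ℝ) = (γ : Matrix (Fin 2) (Fin 2) ℝ)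
  · rw [rademacherP, dif_pos h1, exists_smul_eq_smul h1.choose_spec,
      logEtaP_Gamma0_smul hp.pos]
    have hc : ∀ i j, (γ i j : ℂ) = (h1.choose.1 i j : ℤ) := fun i j => by
      rw [← ofReal_intCast]
      exact congrArg ofReal (congrFun (congrFun h1.choose_spec i) j).symm
    rw [hc, hc]
  have h2 := (mem_Gamma0Plus_cases hp hγ).resolve_left h1
  rw [rademacherP, dif_neg h1, dif_pos h2]
  set g := h2.choose
  have hg : g.1.1.map (Int.cast : ℤ → ℝ) = frickeTwist p γ := h2.choose_spec
  have hpR : (0 : ℝ) < p := by exact_mod_cast hp.pos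
  have hs : 0 < √(p : ℝ) := Real.sqrt_pos.2 hpR
  have hsq : √(p : ℝ) * √p = p := Real.mul_self_sqrt hpR.le
  have g00 : (g.1 0 0 : ℝ) = γ 1 0 / √p := by
    have := congrFun (congrFun hg 0) 0
    simp [frickeTwist] at this
    rw [this]; ring
  have g01 : (g.1 0 1 : ℝ) = γ 1 1 / √p := by
    have := congrFun (congrFun hg 0) 1
    simp [frickeTwist] at this
    rw [this]; ring
  have g10 : (g.1 1 0 : ℝ) = -√p * γ 0 0 := by
    have := congrFun (congrFun hg 1) 0
    simp [frickeTwist] at this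
    rw [this]
    field_simp
    rw [pow_two, hsq]
  have g11 : (g.1 1 1 : ℝ) = -√p * γ 0 1 := by
    have := congrFun (congrFun hg 1) 1
    simp [frickeTwist] at this
    rw [this]
    field_simp
    rw [pow_two, hsq]
  -- If c = 0, then the upper left entry of g vanishes, and p, dividing its lower left entry, would
  -- divide det g = 1.
  have hc0 : γ 1 0 ≠ 0 := by
    intro hc
    have hg0 : g.1 0 0 = 0 := by
      rw [hc, zero_div] at g00
      exact_mod_cast g00
    have hdg := g.1.det_coe
    rw [Matrix.det_fin_two, hg0] at hdg
    have hdvd : (p : ℤ) ∣ g.1 1 0 :=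
      (ZMod.intCast_zmod_eq_zero_iff_dvd _ p).1 (CongruenceSubgroup.Gamma0_mem.1 g.2)
    have h1' : (p : ℤ) ∣ 1 := by
      rw [← hdg, zero_mul, zero_sub]
      exact (hdvd.mul_left _).neg_right
    exact hp.one_lt.ne' (by exact_mod_cast Int.eq_one_of_dvd_one (by positivity) h1')
  have c00 : ((g.1 0 0 : ℤ) : ℂ) = γ 1 0 / √p := by exact_mod_cast congrArg ofReal g00
  have c01 : ((g.1 0 1 : ℤ) : ℂ) = γ 1 1 / √p := by exact_mod_cast congrArg ofReal g01
  have c10 : ((g.1 1 0 : ℤ) : ℂ) = -√p * γ 0 0 := by exact_mod_cast congrArg ofReal g10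
  have c11 : ((g.1 1 1 : ℤ) : ℂ) = -√p * γ 0 1 := by exact_mod_cast congrArg ofReal g11
  have hsC : ((√(p : ℝ) : ℝ) : ℂ) ≠ 0 := by exact_mod_cast hs.ne'
  have hsqC : ((√(p : ℝ) : ℝ) : ℂ) * (√(p : ℝ) : ℝ) = p := by exact_mod_cast congrArg ofReal hsq
  have hv : ((γ 1 0 : ℂ) * z + γ 1 1) ≠ 0 := by
    intro h
    have := congrArg im h
    simp [hc0, z.im_pos.ne'] at this
  have hγz : ((γ • z : ℍ) : ℂ) = ((γ 0 0 : ℂ) * z + γ 0 1) / ((γ 1 0 : ℂ) * z + γ 1 1) :=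
    coe_smul_eq γ z
  have hu0 : ((γ 0 0 : ℂ) * z + γ 0 1) ≠ 0 := by
    intro h
    rw [h, zero_div] at hγz
    exact (γ • z).ne_zero hγz
  -- The twist g is the Fricke involution after γ, so the formulas for g at z and for the involution
  -- at γz determine the value at γz.
  have hw : ((g.1 • z : ℍ) : ℂ) = -1 / (p * (γ • z : ℍ)) := by
    rw [coe_smul_eq, hγz]
    simp only [eq_intCast, ofReal_intCast]
    rw [c00, c01, c10, c11, ← hsqC,
      show -((√(p : ℝ) : ℝ) : ℂ) * γ 0 0 * z + -(√(p : ℝ) : ℝ) * γ 0 1 =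
        -(√(p : ℝ) : ℝ) * ((γ 0 0 : ℂ) * z + γ 0 1) by ring]
    field_simp
  have hF := logEtaP_fricke hp.pos hw
  have hG := logEtaP_Gamma0_smul hp.pos g z
  have huv : (-(√(p : ℝ) : ℝ) * (γ • z : ℍ) : ℂ) * ((γ 1 0 : ℂ) * z + γ 1 1) =
      ((g.1 1 0 : ℤ) : ℂ) * z + (g.1 1 1 : ℤ) := by
    rw [hγz, c10, c11, mul_assoc, div_mul_cancel₀ _ hv]
    ring
  have hu_im : (-(√(p : ℝ) : ℝ) * (γ • z : ℍ) : ℂ).im < 0 := by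
    rw [← ofReal_neg, im_ofReal_mul]
    exact mul_neg_of_neg_of_pos (by linarith) (γ • z).im_pos
  have hv_sign := sign_im_mul_add (z := z) z.im_pos (γ 1 0) (γ 1 1)
  have hg_sign : SignType.sign (((g.1 1 0 : ℤ) : ℂ) * z + (g.1 1 1 : ℤ)).im =
      -SignType.sign (γ 0 0) := by
    have := sign_im_mul_add (z := z) z.im_pos (g.1 1 0) (g.1 1 1)
    rw [ofReal_intCast, ofReal_intCast] at this
    rw [this, g10, sign_mul, Left.sign_neg, sign_pos hs]
    simp
  -- The three signs are -1, sgn c and -sgn a, with product sgn(ac). Half the correction is (πi/4)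
  -- sgn(ac), which is (πi/12)(-3 sgn(-ac)).
  have hmul := autLog_mul (u := -(√(p : ℝ) : ℝ) * (γ • z : ℍ)) (v := (γ 1 0 : ℂ) * z + γ 1 1)
    (fun h => absurd h hu_im.ne) (fun h => ?_) ?_
  · rw [huv, hv_sign, hg_sign, sign_neg hu_im, neg_mul, autLog_neg] at hmul
    have key : logEtaP p (γ • z) = logEtaP p z
        + 1 / 2 * autLog (((g.1 1 0 : ℤ) : ℂ) * z + (g.1 1 1 : ℤ))
        + Real.pi * I / 12 * rademacherGamma0 p g
        - 1 / 2 * autLog ((√(p : ℝ) : ℝ) * (γ • z : ℍ)) := by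
      rw [← hG, hF]
      ring
    rw [key, hmul, Left.sign_neg, sign_mul]
    generalize SignType.sign (γ 0 0) = s
    generalize SignType.sign (γ 1 0) = t
    have hcast : ∀ s t : SignType, (((-(s * t) : SignType) : ℚ) : ℂ) =
        -(((s : ℝ) : ℂ) * ((t : ℝ) : ℂ)) := by
      intro s t
      cases s <;> cases t <;> simp
    push_cast
    have := hcast s t
    push_cast at this
    rw [this]
    simp only [SignType.coe_one, ofReal_one]
    ring
  · rw [← sign_eq_zero_iff, hv_sign, sign_eq_zero_iff] at h
    exact absurd h hc0
  -- The product is real only if a = 0. Then g is upper triangular and integral of determinant 1,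
  -- and its factor is ±1.
  · rw [huv]
    intro h
    rw [← sign_eq_zero_iff, hg_sign] at h
    have ha : γ 0 0 = 0 := by
      rw [← sign_eq_zero_iff]
      revert h
      cases SignType.sign (γ 0 0) <;> decide
    have hg0 : g.1 1 0 = 0 := by
      rw [ha, mul_zero] at g10
      exact_mod_cast g10
    have hdg := g.1.det_coe
    rw [Matrix.det_fin_two, hg0, mul_zero, sub_zero] at hdg
    rw [hg0, Int.cast_zero, zero_mul, zero_add]
    rcases Int.mul_eq_one_iff_eq_one_or_neg_one.1 hdg with ⟨-, h2⟩ | ⟨-, h2⟩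
    · left; exact_mod_cast h2
    · right; exact_mod_cast h2

/-- A continuous logarithm of a `2k`-th root of `Δ_p` differs from `logEtaP` by a constant. -/
lemma sub_logEtaP_eq {p k : ℕ} (hp : 0 < p) (hk : 0 < k) {f L : ℍ → ℂ} (hf : IsEtaP p k f)
    (hL : IsLogBranch f L) (z w : ℍ) : L z - logEtaP p z = L w - logEtaP p w := by
  have hk0 : ((2 * k : ℕ) : ℂ) ≠ 0 := by exact_mod_cast (by omega : 2 * k ≠ 0)
  have := sub_eq_sub_of_exp_eq (f := fun z => ((2 * k : ℕ) : ℂ) * L z)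
    (g := fun z => ((2 * k : ℕ) : ℂ) * logEtaP p z) (continuous_const.mul hL.1)
    (continuous_const.mul (continuous_logEtaP hp)) (fun z => by
      rw [exp_nat_mul, exp_nat_mul, hL.2, hf.2, exp_logEtaP_pow hp]) z w
  rw [← mul_sub, ← mul_sub] at this
  exact mul_left_cancel₀ hk0 this

end EtaFricke


/-! ### The normalized branch and the formula for every branch -/

theorem theorem1 (p : ℕ) (hp : p.Prime) (hp2 : p ≠ 2) (k : ℕ) (hk : 0 < k) :
    (∃ f L : ℍ → ℂ, EtaFricke.IsEtaP p k f ∧ EtaFricke.IsLogBranch f L ∧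
      ∀ z : ℍ, z.re = 0 →
        f z = EtaFricke.deltaP p k z ^ (1 / (2 * (k : ℂ))) ∧ L z = Complex.log (f z)) ∧
    ∀ f L : ℍ → ℂ, EtaFricke.IsEtaP p k f → EtaFricke.IsLogBranch f L →
      ∀ γ ∈ EtaFricke.Gamma0Plus p, ∀ z : ℍ,
        L (γ • z) = L z
          + 1 / 2 * ((SignType.sign (γ 1 0) : ℝ) : ℂ) ^ 2 *
            Complex.log (((γ 1 0 : ℝ) * (z : ℂ) + (γ 1 1 : ℝ)) /
              (Complex.I * ((SignType.sign (γ 1 0) : ℝ) : ℂ)))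
          + Real.pi * Complex.I / 12 * (EtaFricke.rademacherP p γ : ℂ) := by
  constructor
  · refine ⟨fun z => Complex.exp (EtaFricke.logEtaP p z), EtaFricke.logEtaP p,
      ⟨(EtaFricke.continuous_logEtaP hp.pos).cexp, EtaFricke.exp_logEtaP_pow hp.pos k⟩,
      ⟨EtaFricke.continuous_logEtaP hp.pos, fun z => rfl⟩, fun z hz => ?_⟩
    have him := EtaFricke.logEtaP_im_eq_zero hp.pos hz
    have hlog : Complex.log (Complex.exp (EtaFricke.logEtaP p z)) = EtaFricke.logEtaP p z :=
      Complex.log_exp (by rw [him]; linarith [Real.pi_pos]) (by rw [him]; exact Real.pi_pos.le)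
    refine ⟨?_, hlog.symm⟩
    have hk0 : (k : ℂ) ≠ 0 := by exact_mod_cast hk.ne'
    -- Since 2k·`logEtaP` is real here, it is the principal logarithm of Δ_p, so the principal 2k-th
    -- root is exp(`logEtaP`).
    have him2 : (((2 * k : ℕ) : ℂ) * EtaFricke.logEtaP p z).im = 0 := by
      rw [← Complex.ofReal_natCast, Complex.im_ofReal_mul, him, mul_zero]
    rw [← EtaFricke.exp_logEtaP_pow hp.pos k z, ← Complex.exp_nat_mul,
      Complex.cpow_def_of_ne_zero (Complex.exp_ne_zero _),
      Complex.log_exp (by rw [him2]; linarith [Real.pi_pos]) (by rw [him2]; exact Real.pi_pos.le)]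
    push_cast
    field_simp
  · intro f L hf hL γ hγ z
    have h1 := EtaFricke.sub_logEtaP_eq hp.pos hk hf hL (γ • z) z
    have h2 := EtaFricke.logEtaP_smul hp hγ z
    have h3 := EtaFricke.sign_im_mul_add z.im_pos (γ 1 0) (γ 1 1)
    rw [EtaFricke.autLog, h3] at h2
    linear_combination h1 + h2
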